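/- Trees are finite ordered unranked trees with labels in a finite alphabet $\Sigma$. For trees $t,t'$ let $t\cdot t'$ be the set of trees obtained from $t'$ by replacing one leaf (an occurrence of a leaf, possibly the root) by $t$, and for sets of trees let $L\cdot L'=\bigcup_{t\in L,\,t'\in L'}t\cdot t'$. A weakly deterministic tree automaton (WDTA) over $\Sigma$ consists of a finite set $Q$ of vertical states, a set $F\subseteq Q$ of final states, and regular horizontal languages $\delta(q,a)\subseteq(Q\cup\Sigma)^*$ ($q\in Q$, $a\in\Sigma$), with $\delta(q_1,a)\cap\delta(q_2,a)=\emptyset$ for $q_1\ne q_2$. In a strongly deterministic tree automaton (SDTA) the languages $\delta(q,a)$, $q\in Q$, are instead given for each $a$ by a single finite (possibly partial) DFA over $Q\cup\Sigma$ with an output function $\lambda_a$ from its accepting states to $Q$: $w\in\delta(q,a)$ iff the DFA reaches on $w$ an accepting state with output $q$. Automata need not be complete. The computation goes bottom-up: a node labelled $a$ gets state $q$ if the sequence of its children is read as a word in $\delta(q,a)$ (the empty word for a leaf), where a child is read as its state, and a leaf child that gets no state is read as its label. A tree is accepted if its root gets a state in $F$; $L(A)$ is the set of accepted trees. We say that the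 leaves of $A$ carry states if, whenever a label $a\in\Sigma$ occurs as a letter in a word of some horizontal language of $A$, a leaf labelled $a$ gets a state (this holds in particular if all horizontal languages are subsets of $Q^*$). Theorem. 1. Let $A_1$ and $A_2$ be SDTAs over $\Sigma$ with vertical state sets $Q_1\neq\emptyset$ and $Q_2$, and suppose that the leaves of $A_1$ carry states. Then $L(A_2)\cdot L(A_1)$ is recognized by an SDTA with at most $(|Q_1|+1)\bigl(2^{|Q_1|}(|Q_2|+1)-2^{|Q_1|-1}\bigr)-1$ vertical states. 2. There is a fixed finite alphabet $\Sigma$ such that for all integers $m,n\ge 1$ there are tree languages $T_A$ and $T_B$ over $\Sigma$, where $T_A$ is recognized by an SDTA with $m$ vertical states and $T_B$ by an SDTA with $n$ vertical states whose leaves carry states, such that every SDTA recognizing $T_A\cdot T_B$ has at least $(n+1)\bigl((m+1)2^n-2^{n-1}\bigr)-1$ vertical states. 3. Both 1 and 2 also hold with WDTAs in place of SDTAs. -/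

import Mathlib

/-- Finite unranked ordered trees with labels in `α`: a root label and the (possibly empty) list of
the immediate subtrees. A leaf is a tree of the form `node a []`. -/
inductive UTree (α : Type*) where
  | node (a : α) (children : List (UTree α)) : UTree α

namespace UTree

/-- `ReplaceLeaf t t' s`: the tree `s` arises from `t'` by replacing exactly one leaf (an occurrence
of a leaf, possibly the root) by the tree `t`. -/
inductive ReplaceLeaf {α : Type*} (t : UTree α) : UTree α → UTree α → Prop where
  | root (a : α) : ReplaceLeaf t (node a []) t
  | child (a : α) (l r : List (UTree α)) (t' s : UTree α) (h : ReplaceLeaf t t' s) :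
      ReplaceLeaf t (node a (l ++ t' :: r)) (node a (l ++ s :: r))

/-- Tree concatenation `L₁ · L₂`: in some tree of `L₂` one leaf is replaced by a tree of `L₁`. -/
def concat {α : Type*} (L₁ L₂ : Set (UTree α)) : Set (UTree α) :=
  {s | ∃ t ∈ L₁, ∃ t' ∈ L₂, ReplaceLeaf t t' s}

end UTree

/-- A family of horizontal languages over states `Q` and labels `α`: `δ q a` is the set of words over
`Q ∪ α` that send an `a`-labelled node to state `q`. -/
abbrev Horizontal (α Q : Type*) := Q → α → Language (Q ⊕ α)

namespace Horizontal

universe u v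

mutual

/-- `Reaches δ t q`: the bottom-up computation assigns state `q` to the root of `t`. -/
inductive Reaches {α : Type u} {Q : Type v} (δ : Horizontal α Q) : UTree α → Q → Prop where
  | node (a : α) (ts : List (UTree α)) (w : List (Q ⊕ α)) (q : Q)
      (hr : ReadAs δ ts w) (hw : w ∈ δ q a) : Reaches δ (UTree.node a ts) q

/-- `ReadAs δ ts w`: the list `ts` of sibling subtrees is read as the word `w` over `Q ∪ α`.
A subtree is read as the state assigned to its root. A letter `b` of `α` in `w` always stands for a
leaf labelled `b`; so that computations stay unique, a leaf is read as its label only if no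
state is assigned to it. -/
inductive ReadAs {α : Type u} {Q : Type v} (δ : Horizontal α Q) : List (UTree α) → List (Q ⊕ α) → Prop where
  | nil : ReadAs δ [] []
  | state (t : UTree α) (q : Q) (ts : List (UTree α)) (w : List (Q ⊕ α))
      (ht : Reaches δ t q) (hr : ReadAs δ ts w) : ReadAs δ (t :: ts) (Sum.inl q :: w)
  | symbol (b : α) (ts : List (UTree α)) (w : List (Q ⊕ α))
      (hb : ∀ q, [] ∉ δ q b) (hr : ReadAs δ ts w) :
      ReadAs δ (UTree.node b [] :: ts) (Sum.inr b :: w)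

end

/-- Trees on which the computation ends in a state of `F`. -/
def language {α Q : Type*} (δ : Horizontal α Q) (F : Set Q) : Set (UTree α) :=
  {t | ∃ q ∈ F, Reaches δ t q}

/-- Every leaf that occurs in accepted horizontal words carries a state: a label `a` that is used as
a leaf symbol in some word of some horizontal language has a state assigned to its leaves. In
particular this holds if all horizontal languages are sets of words over `Q` alone. -/
def LeavesCarryStates {α Q : Type*} (δ : Horizontal α Q) : Prop :=
  ∀ (q : Q) (b : α) (w : List (Q ⊕ α)) (a : α), w ∈ δ q b → Sum.inr a ∈ w → ∃ p, [] ∈ δ p a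

end Horizontal

/-- Weakly deterministic unranked tree automata (not necessarily complete) with label alphabet `α`
and vertical states `Q`: for each label the horizontal languages are regular (given by DFAs)
and pairwise disjoint. -/
structure WDTA (α Q : Type*) where
  δ : Horizontal α Q
  regular : ∀ q a, (δ q a).IsRegular
  disjoint : ∀ a q₁ q₂, q₁ ≠ q₂ → Disjoint (δ q₁ a : Set (List (Q ⊕ α))) (δ q₂ a)
  final : Set Q

namespace WDTA

def language {α Q : Type*} (A : WDTA α Q) : Set (UTree α) := A.δ.language A.final

end WDTA

/-- Strongly deterministic unranked tree automata (not necessarily complete) with label alphabet `α`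
and vertical states `Q`: for each label `a` one finite (partial) DFA over `Q ∪ α` with states `H a`
and an output function `out a` into `Q`, defined on the accepting states of the DFA (that is,
the accepting states are those with `out a s ≠ none`). -/
structure SDTA (α Q : Type*) where
  H : α → Type
  finite : ∀ a, Finite (H a)
  init : ∀ a, H a
  step : ∀ a, H a → Q ⊕ α → Option (H a)
  out : ∀ a, H a → Option Q
  final : Set Q

namespace SDTA

/-- The state of the DFA for `a` after reading `w` from its initial state, if defined. -/
def run {α Q : Type*} (A : SDTA α Q) (a : α) (w : List (Q ⊕ α)) : Option (A.H a) :=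
  w.foldlM (A.step a) (A.init a)

/-- The horizontal languages of a strongly deterministic automaton: `w ∈ δ q a` iff the output at the
state reached by the DFA for `a` on `w` is `q`. -/
def δ {α Q : Type*} (A : SDTA α Q) : Horizontal α Q :=
  fun q a => {w | (A.run a w).bind (A.out a) = some q}

def language {α Q : Type*} (A : SDTA α Q) : Set (UTree α) := A.δ.language A.final

end SDTA

universe u

namespace UTree

/-- The letter as which a tree is read by its parent, given the state assigned to its root: this
state if there is one, else the label of a leaf. -/
def letter {α Q : Type u} : Option Q → UTree α → Option (Q ⊕ α)
  | some q, _ => some (Sum.inl q)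
  | none, node b [] => some (Sum.inr b)
  | none, node _ (_ :: _) => none

mutual

/-- The state assigned to a tree when `out a w` is the state of an `a`-labelled node whose children
are read as `w`. -/
def value {α Q : Type u} (out : α → List (Q ⊕ α) → Option Q) : UTree α → Option Q
  | node a ts => (word out ts).bind (out a)

/-- The word as which a list of sibling trees is read. -/
def word {α Q : Type u} (out : α → List (Q ⊕ α) → Option Q) :
    List (UTree α) → Option (List (Q ⊕ α))
  | [] => some []
  | t :: ts => (letter (value out t) t).bind fun x => (word out ts).map (x :: ·)

end

mutual

/-- The state assigned to a tree by a bottom-up computation that reads states only. -/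
def pureValue {α Q : Type u} (f : α → List Q → Option Q) : UTree α → Option Q
  | node a ts => (pureWord f ts).bind (f a)

/-- The word of states assigned to a list of sibling trees. -/
def pureWord {α Q : Type u} (f : α → List Q → Option Q) : List (UTree α) → Option (List Q)
  | [] => some []
  | t :: ts => (pureValue f t).bind fun x => (pureWord f ts).map (x :: ·)

end

theorem pureWord_append {α Q : Type u} (f : α → List Q → Option Q) (l r : List (UTree α)) :
    pureWord f (l ++ r) = (pureWord f l).bind fun u => (pureWord f r).map (u ++ ·) := by
  induction l with
  | nil => cases h : pureWord f r <;> simp [pureWord, h]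
  | cons t l ih =>
    simp only [List.cons_append, pureWord, ih]
    cases pureValue f t <;> cases pureWord f l <;> cases pureWord f r <;> simp

theorem word_append {α Q : Type u} (out : α → List (Q ⊕ α) → Option Q) (l r : List (UTree α)) :
    word out (l ++ r) = (word out l).bind fun u => (word out r).map (u ++ ·) := by
  induction l with
  | nil => cases h : word out r <;> simp [word, h]
  | cons t l ih =>
    simp only [List.cons_append, word, ih]
    cases letter (value out t) t <;> cases word out l <;> cases word out r <;> simp

theorem pureWord_replicate {α Q : Type u} (f : α → List Q → Option Q) {t : UTree α} {q : Q}
    (h : pureValue f t = some q) (n : ℕ) :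
    pureWord f (List.replicate n t) = some (List.replicate n q) := by
  induction n with
  | zero => simp [pureWord]
  | succ n ih => simp [List.replicate_succ, pureWord, h, ih]

theorem word_replicate {α Q : Type u} (out : α → List (Q ⊕ α) → Option Q) {t : UTree α} {x : Q ⊕ α}
    (h : letter (value out t) t = some x) (n : ℕ) :
    word out (List.replicate n t) = some (List.replicate n x) := by
  induction n with
  | zero => simp [word]
  | succ n ih => simp [List.replicate_succ, word, h, ih]

theorem replaceLeaf_node {α : Type*} {t t' : UTree α} {a : α} {ts : List (UTree α)} :
    ReplaceLeaf t t' (node a ts) ↔ (node a ts = t ∧ ∃ b, t' = node b []) ∨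
      ∃ l x y r, ts = l ++ y :: r ∧ t' = node a (l ++ x :: r) ∧ ReplaceLeaf t x y := by
  constructor
  · intro h
    generalize hs : node a ts = s at h
    cases h with
    | root b => exact Or.inl ⟨rfl, b, rfl⟩
    | child b l r x y h =>
      injection hs with h1 h2
      subst h1
      exact Or.inr ⟨l, x, y, r, h2, rfl, h⟩
  · rintro (⟨rfl, b, rfl⟩ | ⟨l, x, y, r, rfl, rfl, h⟩)
    · exact .root b
    · exact .child a l r x y h

/-- The states assigned to the trees from which `t` arises by replacing a leaf by a tree of `L`. -/
def graftValues {α Q : Type u} (f : α → List Q → Option Q) (L : Set (UTree α)) (t : UTree α) :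
    Set Q :=
  {q | ∃ t₀ ∈ L, ∃ t', ReplaceLeaf t₀ t' t ∧ pureValue f t' = some q}

/-- The words of states assigned to the lists of trees from which `ts` arises by replacing a leaf
by a tree of `L`. -/
def graftWords {α Q : Type u} (f : α → List Q → Option Q) (L : Set (UTree α))
    (ts : List (UTree α)) : Set (List Q) :=
  {w | ∃ t₀ ∈ L, ∃ l x y r, ts = l ++ y :: r ∧ ReplaceLeaf t₀ x y ∧
    pureWord f (l ++ x :: r) = some w}

theorem mem_graftValues_node {α Q : Type u} {f : α → List Q → Option Q} {L : Set (UTree α)} {a : α}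
    {ts : List (UTree α)} {q : Q} :
    q ∈ graftValues f L (node a ts) ↔
      (node a ts ∈ L ∧ ∃ b, f b [] = some q) ∨ ∃ w ∈ graftWords f L ts, f a w = some q := by
  simp only [graftValues, graftWords, Set.mem_ofPred_eq, replaceLeaf_node]
  constructor
  · rintro ⟨t₀, h₀, t', ⟨rfl, b, rfl⟩ | ⟨l, x, y, r, rfl, rfl, h⟩, hq⟩
    · exact Or.inl ⟨h₀, b, by simpa [pureValue, pureWord] using hq⟩
    · rw [pureValue, Option.bind_eq_some_iff] at hq
      obtain ⟨w, hw, hq⟩ := hq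
      exact Or.inr ⟨w, ⟨t₀, h₀, l, x, y, r, rfl, h, hw⟩, hq⟩
  · rintro (⟨h, b, hb⟩ | ⟨w, ⟨t₀, h₀, l, x, y, r, rfl, h, hw⟩, hq⟩)
    · exact ⟨_, h, node b [], Or.inl ⟨rfl, b, rfl⟩, by simpa [pureValue, pureWord] using hb⟩
    · refine ⟨t₀, h₀, _, Or.inr ⟨l, x, y, r, rfl, rfl, h⟩, ?_⟩
      simp [pureValue, hw, hq]

theorem graftWords_nil {α Q : Type u} {f : α → List Q → Option Q} {L : Set (UTree α)} :
    graftWords f L [] = ∅ := by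
  simp [graftWords]

theorem mem_graftWords_singleton {α Q : Type u} {f : α → List Q → Option Q} {L : Set (UTree α)}
    {t : UTree α} {w : List Q} :
    w ∈ graftWords f L [t] ↔ ∃ q ∈ graftValues f L t, w = [q] := by
  constructor
  · rintro ⟨t₀, h₀, l, x, y, r, hl, h, hw⟩
    obtain ⟨rfl, rfl, rfl⟩ : l = [] ∧ y = t ∧ r = [] := by
      cases l with
      | nil => simpa [eq_comm] using hl
      | cons => simp at hl
    cases hx : pureValue f x with
    | none => simp [pureWord, hx] at hw
    | some q => exact ⟨q, ⟨t₀, h₀, x, h, hx⟩, by simpa [pureWord, hx, eq_comm] using hw⟩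
  · rintro ⟨q, ⟨t₀, h₀, x, h, hx⟩, rfl⟩
    exact ⟨t₀, h₀, [], x, t, [], rfl, h, by simp [pureWord, hx]⟩

theorem mem_graftWords_append {α Q : Type u} {f : α → List Q → Option Q} {L : Set (UTree α)}
    {l r : List (UTree α)} {w : List Q} :
    w ∈ graftWords f L (l ++ r) ↔
      (∃ u ∈ graftWords f L l, ∃ v, pureWord f r = some v ∧ w = u ++ v) ∨
      ∃ u, pureWord f l = some u ∧ ∃ v ∈ graftWords f L r, w = u ++ v := by
  constructor
  · rintro ⟨t₀, h₀, l', x, y, r', hl, h, hw⟩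
    rw [List.append_eq_append_iff] at hl
    rcases hl with ⟨m, rfl, rfl⟩ | ⟨m, rfl, hm⟩
    · rw [List.append_assoc, pureWord_append, Option.bind_eq_some_iff] at hw
      obtain ⟨u, hu, hw⟩ := hw
      obtain ⟨v, hv, rfl⟩ := Option.map_eq_some_iff.1 hw
      exact Or.inr ⟨u, hu, v, ⟨t₀, h₀, m, x, y, r', rfl, h, hv⟩, rfl⟩
    · cases m with
      | nil =>
        rw [List.nil_append] at hm
        subst hm
        rw [pureWord_append, Option.bind_eq_some_iff] at hw
        obtain ⟨u, hu, hw⟩ := hw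
        obtain ⟨v, hv, rfl⟩ := Option.map_eq_some_iff.1 hw
        exact Or.inr ⟨u, by simpa using hu, v, ⟨t₀, h₀, [], x, y, r', rfl, h, hv⟩, rfl⟩
      | cons z m =>
        rw [List.cons_append] at hm
        injection hm with h1 h2
        subst h1 h2
        rw [← List.cons_append, ← List.append_assoc, pureWord_append,
          Option.bind_eq_some_iff] at hw
        obtain ⟨u, hu, hw⟩ := hw
        obtain ⟨v, hv, rfl⟩ := Option.map_eq_some_iff.1 hw
        exact Or.inl ⟨u, ⟨t₀, h₀, l', x, y, m, rfl, h, hu⟩, v, hv, rfl⟩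
  · rintro (⟨u, ⟨t₀, h₀, l', x, y, r', rfl, h, hu⟩, v, hv, rfl⟩ |
      ⟨u, hu, v, ⟨t₀, h₀, l', x, y, r', rfl, h, hv⟩, rfl⟩)
    · refine ⟨t₀, h₀, l', x, y, r' ++ r, by simp, h, ?_⟩
      rw [← List.cons_append, ← List.append_assoc, pureWord_append, hu, hv]
      rfl
    · refine ⟨t₀, h₀, l ++ l', x, y, r', by simp, h, ?_⟩
      rw [List.append_assoc, pureWord_append, hu, hv]
      rfl

theorem mem_graftWords_cons {α Q : Type u} {f : α → List Q → Option Q} {L : Set (UTree α)}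
    {t : UTree α} {ts : List (UTree α)} {w : List Q} :
    w ∈ graftWords f L (t :: ts) ↔
      (∃ q ∈ graftValues f L t, ∃ v, pureWord f ts = some v ∧ w = q :: v) ∨
      ∃ q, pureValue f t = some q ∧ ∃ v ∈ graftWords f L ts, w = q :: v := by
  rw [← List.singleton_append, mem_graftWords_append]
  simp only [mem_graftWords_singleton]
  constructor
  · rintro (⟨_, ⟨q, hq, rfl⟩, v, hv, rfl⟩ | ⟨u, hu, v, hv, rfl⟩)
    · exact Or.inl ⟨q, hq, v, hv, rfl⟩
    · cases h : pureValue f t with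
      | none => simp [pureWord, h] at hu
      | some q =>
        obtain rfl : [q] = u := by simpa [pureWord, h] using hu
        exact Or.inr ⟨q, rfl, v, hv, rfl⟩
  · rintro (⟨q, hq, v, hv, rfl⟩ | ⟨q, hq, v, hv, rfl⟩)
    · exact Or.inl ⟨_, ⟨q, hq, rfl⟩, v, hv, rfl⟩
    · exact Or.inr ⟨[q], by simp [pureWord, hq], v, hv, rfl⟩

theorem graftWords_replicate {α Q : Type u} {f : α → List Q → Option Q} {L : Set (UTree α)}
    {t : UTree α} (h : graftValues f L t = ∅) (n : ℕ) :
    graftWords f L (List.replicate n t) = ∅ := by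
  induction n with
  | zero => exact graftWords_nil
  | succ n ih =>
    ext w
    simp [List.replicate_succ, mem_graftWords_cons, h, ih]

end UTree

namespace Horizontal

open UTree

mutual

theorem reaches_iff_value {α Q : Type u} {δ : Horizontal α Q} {out : α → List (Q ⊕ α) → Option Q}
    (h : ∀ q a w, w ∈ δ q a ↔ out a w = some q) :
    ∀ t q, Reaches δ t q ↔ value out t = some q
  | .node a ts, q => by
    rw [value, Option.bind_eq_some_iff]
    constructor
    · rintro ⟨_, _, w, _, hr, hw⟩
      exact ⟨w, (readAs_iff_word h ts w).1 hr, (h q a w).1 hw⟩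
    · rintro ⟨w, hr, hw⟩
      exact .node a ts w q ((readAs_iff_word h ts w).2 hr) ((h q a w).2 hw)

theorem readAs_iff_word {α Q : Type u} {δ : Horizontal α Q} {out : α → List (Q ⊕ α) → Option Q}
    (h : ∀ q a w, w ∈ δ q a ↔ out a w = some q) :
    ∀ ts w, ReadAs δ ts w ↔ word out ts = some w
  | [], w => by
    rw [word, Option.some_inj]
    constructor
    · rintro ⟨⟩
      rfl
    · rintro rfl
      exact .nil
  | t :: ts, w => by
    rw [word, Option.bind_eq_some_iff]
    constructor
    · intro hr
      cases hr with
      | state _ q _ w ht hr =>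
        refine ⟨Sum.inl q, ?_, ?_⟩
        · rw [(reaches_iff_value h t q).1 ht, letter]
        · rw [(readAs_iff_word h ts w).1 hr, Option.map_some]
      | symbol b _ w hb hr =>
        refine ⟨Sum.inr b, ?_, ?_⟩
        · have : value out (.node b []) = none := by
            rw [value, word, Option.bind_some, Option.eq_none_iff_forall_not_mem]
            exact fun q hq => hb q ((h q b []).2 hq)
          rw [this, letter]
        · rw [(readAs_iff_word h ts w).1 hr, Option.map_some]
    · rintro ⟨x, hx, hw⟩
      obtain ⟨v, hv, rfl⟩ := Option.map_eq_some_iff.1 hw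
      have hr := (readAs_iff_word h ts v).2 hv
      cases ht : value out t with
      | some q =>
        rw [ht, letter, Option.some_inj] at hx
        subst hx
        exact .state t q ts v ((reaches_iff_value h t q).2 ht) hr
      | none =>
        rw [ht] at hx
        match t, ht, hx with
        | .node b [], ht, hx =>
          rw [letter, Option.some_inj] at hx
          subst hx
          refine .symbol b ts v (fun q hq => ?_) hr
          rw [h] at hq
          simp [value, word, hq] at ht
        | .node b (_ :: _), ht, hx => simp [letter] at hx

end

theorem ReadAs.nil_notMem {α Q : Type u} {δ : Horizontal α Q} :
    ∀ {ts : List (UTree α)} {w : List (Q ⊕ α)}, ReadAs δ ts w → ∀ {b : α}, Sum.inr b ∈ w →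
      ∀ q, [] ∉ δ q b
  | _, _, .nil, b, hb => by simp at hb
  | _, _, .state t q ts w ht hr, b, hb => hr.nil_notMem (by simpa using hb)
  | _, _, .symbol c ts w hc hr, b, hb => by
    rcases List.mem_cons.1 hb with h | h
    · cases h
      exact hc
    · exact hr.nil_notMem h

theorem exists_map_inl {Q α : Type*} (w : List (Q ⊕ α)) (h : ∀ a, Sum.inr a ∉ w) :
    ∃ v : List Q, w = v.map Sum.inl := by
  induction w with
  | nil => exact ⟨[], rfl⟩
  | cons x w ih =>
    obtain ⟨v, rfl⟩ := ih fun a ha => h a (List.mem_cons_of_mem _ ha)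
    cases x with
    | inl q => exact ⟨q :: v, rfl⟩
    | inr a => exact absurd (List.mem_cons_self) (h a)

mutual

theorem LeavesCarryStates.reaches_iff {α Q : Type u} {δ : Horizontal α Q}
    {f : α → List Q → Option Q} (hδ : δ.LeavesCarryStates)
    (h : ∀ q a (w : List Q), w.map Sum.inl ∈ δ q a ↔ f a w = some q) :
    ∀ t q, Reaches δ t q ↔ pureValue f t = some q
  | .node a ts, q => by
    rw [pureValue, Option.bind_eq_some_iff]
    constructor
    · rintro ⟨_, _, w, _, hr, hw⟩
      obtain ⟨v, rfl⟩ := exists_map_inl w fun b hb => by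
        obtain ⟨p, hp⟩ := hδ q a w b hw hb
        exact hr.nil_notMem hb p hp
      exact ⟨v, (hδ.readAs_iff h ts v).1 hr, (h q a v).1 hw⟩
    · rintro ⟨w, hr, hw⟩
      exact .node a ts _ q ((hδ.readAs_iff h ts w).2 hr) ((h q a w).2 hw)

theorem LeavesCarryStates.readAs_iff {α Q : Type u} {δ : Horizontal α Q}
    {f : α → List Q → Option Q} (hδ : δ.LeavesCarryStates)
    (h : ∀ q a (w : List Q), w.map Sum.inl ∈ δ q a ↔ f a w = some q) :
    ∀ ts (w : List Q), ReadAs δ ts (w.map Sum.inl) ↔ pureWord f ts = some w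
  | [], w => by
    rw [pureWord, Option.some_inj]
    constructor
    · intro hr
      cases w with
      | nil => rfl
      | cons => cases hr
    · rintro rfl
      exact .nil
  | t :: ts, w => by
    rw [pureWord, Option.bind_eq_some_iff]
    constructor
    · intro hr
      cases w with
      | nil => cases hr
      | cons q w =>
        rw [List.map_cons] at hr
        cases hr with
        | state _ q _ w ht hr =>
        exact ⟨q, (hδ.reaches_iff h t q).1 ht, by rw [(hδ.readAs_iff h ts w).1 hr, Option.map_some]⟩
    · rintro ⟨q, ht, hw⟩
      obtain ⟨v, hv, rfl⟩ := Option.map_eq_some_iff.1 hw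
      exact .state t q ts _ ((hδ.reaches_iff h t q).2 ht) ((hδ.readAs_iff h ts v).2 hv)

end

theorem mem_language_iff {α Q : Type u} {δ : Horizontal α Q} {out : α → List (Q ⊕ α) → Option Q}
    (h : ∀ q a w, w ∈ δ q a ↔ out a w = some q) {F : Set Q} {t : UTree α} :
    t ∈ δ.language F ↔ ∃ q ∈ F, value out t = some q := by
  simp only [language, Set.mem_ofPred_eq, reaches_iff_value h]

theorem LeavesCarryStates.mem_concat_iff {α Q : Type u} {δ : Horizontal α Q}
    {f : α → List Q → Option Q} (hδ : δ.LeavesCarryStates)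
    (h : ∀ q a (w : List Q), w.map Sum.inl ∈ δ q a ↔ f a w = some q) {F : Set Q}
    {L : Set (UTree α)} {t : UTree α} :
    t ∈ concat L (δ.language F) ↔ ∃ q ∈ F, q ∈ graftValues f L t := by
  simp only [concat, language, graftValues, Set.mem_ofPred_eq, hδ.reaches_iff h]
  constructor
  · rintro ⟨t₀, h₀, t', ⟨q, hq, ht⟩, hr⟩
    exact ⟨q, hq, t₀, h₀, t', hr, ht⟩
  · rintro ⟨q, hq, t₀, h₀, t', hr, ht⟩
    exact ⟨t₀, h₀, t', ⟨q, hq, ht⟩, hr⟩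

end Horizontal

namespace SDTA

/-- The output of the automaton at an `a`-labelled node whose children are read as `w`. -/
def outWord {α Q : Type u} (A : SDTA α Q) (a : α) (w : List (Q ⊕ α)) : Option Q :=
  (A.run a w).bind (A.out a)

theorem mem_δ {α Q : Type u} (A : SDTA α Q) (q : Q) (a : α) (w : List (Q ⊕ α)) :
    w ∈ A.δ q a ↔ A.outWord a w = some q := Iff.rfl

end SDTA

open UTree

/-- The possible values, at a tree, of the triple consisting of the state of the first automaton, its
states after undoing a graft, and the state of the second automaton. Excluded are the triple that
carries no information and those triples for which the tree is recognized by the second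
automaton (in state `f`) but cannot be replaced by a leaf (with state `q₀`). -/
def graftTriples {Q₁ Q₂ : Type*} (q₀ : Q₁) (f : Q₂) : Set (Option Q₁ × Set Q₁ × Option Q₂) :=
  {x | x ≠ (none, ∅, none) ∧ (x.2.2 = some f → q₀ ∈ x.2.1)}

theorem ncard_graftTriples {Q₁ Q₂ : Type*} [Fintype Q₁] [Fintype Q₂] (q₀ : Q₁) (f : Q₂) :
    (graftTriples q₀ f).ncard = (Fintype.card Q₁ + 1) *
      (2 ^ Fintype.card Q₁ * (Fintype.card Q₂ + 1) - 2 ^ (Fintype.card Q₁ - 1)) - 1 := by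
  classical
  have h₁ : {S : Set Q₁ | q₀ ∉ S}.ncard = 2 ^ (Fintype.card Q₁ - 1) := by
    have : {S : Set Q₁ | q₀ ∉ S} = 𝒫 {q₀}ᶜ := by
      ext S
      simp [Set.mem_powerset_iff]
    rw [this, Set.ncard_powerset _ (Set.toFinite _), Set.ncard_compl, Set.ncard_singleton,
      Nat.card_eq_fintype_card]
  let T : Set (Option Q₁ × Set Q₁ × Option Q₂) := Set.univ ×ˢ {S : Set Q₁ | q₀ ∉ S} ×ˢ {some f}
  have hT : T.ncard = (Fintype.card Q₁ + 1) * 2 ^ (Fintype.card Q₁ - 1) := by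
    rw [Set.ncard_prod, Set.ncard_prod, h₁, Set.ncard_univ, Set.ncard_singleton,
      Nat.card_eq_fintype_card, Fintype.card_option, mul_one]
  have hR : graftTriples q₀ f = Tᶜ \ {(none, ∅, none)} := by
    ext ⟨p, S, q⟩
    simp only [graftTriples, T, Set.mem_ofPred_eq, Set.mem_sdiff, Set.mem_compl_iff, Set.mem_prod,
      Set.mem_univ, Set.mem_singleton_iff]
    tauto
  have hU : Nat.card (Option Q₁ × Set Q₁ × Option Q₂) =
      (Fintype.card Q₁ + 1) * (2 ^ Fintype.card Q₁ * (Fintype.card Q₂ + 1)) := by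
    simp [Nat.card_eq_fintype_card, Fintype.card_prod, Fintype.card_option, Fintype.card_set]
  rw [hR, Set.ncard_sdiff_singleton_of_mem (by simp [T]), Set.ncard_compl, hT, hU, Nat.mul_sub]


namespace SDTA

theorem mem_language {α Q : Type} {A : SDTA α Q} {t : UTree α} :
    t ∈ A.language ↔ ∃ q ∈ A.final, value A.outWord t = some q :=
  Horizontal.mem_language_iff A.mem_δ

theorem exists_fin {α P : Type} (B : SDTA α P) {R : Set P} (hR : R.Finite)
    (h : ∀ t q, value B.outWord t = some q → q ∈ R) :
    ∃ B' : SDTA α (Fin R.ncard), B'.language = B.language := by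
  classical
  have : Finite R := hR
  let e : R ≃ Fin R.ncard := Finite.equivFin R
  let g : Fin R.ncard → P := fun i => e.symm i
  let c : P → Option (Fin R.ncard) := fun q => if hq : q ∈ R then some (e ⟨q, hq⟩) else none
  let B' : SDTA α (Fin R.ncard) :=
    { H := B.H
      finite := B.finite
      init := B.init
      step := fun a s x => B.step a s (x.map g id)
      out := fun a s => (B.out a s).bind c
      final := g ⁻¹' B.final }
  have hc : ∀ i, c (g i) = some i := fun i => by simp [c, g]
  have hgc : ∀ q ∈ R, (c q).map g = some q := fun q hq => by simp [c, g, hq]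
  have hrun : ∀ a w, B'.run a w = B.run a (w.map (Sum.map g id)) := by
    intro a w
    simp only [run, List.foldlM_map]
    rfl
  have hout : ∀ a w, B'.outWord a w = (B.outWord a (w.map (Sum.map g id))).bind c := by
    intro a w
    simp only [outWord, hrun, Option.bind_assoc]
    rfl
  have key : ∀ t, value B.outWord t = (value B'.outWord t).map g := by
    have hl : ∀ t : UTree α, value B.outWord t = (value B'.outWord t).map g →
        letter (value B.outWord t) t = (letter (value B'.outWord t) t).map (Sum.map g id) := by
      intro t ht
      rw [ht]
      match t, value B'.outWord t with
      | t, some q => rfl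
      | node b [], none => rfl
      | node b (_ :: _), none => rfl
    intro t
    induction t using UTree.rec (motive_2 := fun ts =>
      word B.outWord ts = (word B'.outWord ts).map (List.map (Sum.map g id))) with
    | node a ts ih =>
      have hv := h (node a ts)
      rw [value, ih] at hv
      rw [value, value, ih]
      cases hw : word B'.outWord ts with
      | none => simp
      | some w =>
        simp only [hw, Option.map_some, Option.bind_some] at hv ⊢
        rw [hout]
        cases hq : B.outWord a (w.map (Sum.map g id)) with
        | none => simp
        | some q => rw [Option.bind_some, hgc q (hv q hq)]
    | nil => simp [word]
    | cons t ts ih₁ ih₂ =>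
      rw [word, word, ih₂, hl t ih₁]
      cases letter (value B'.outWord t) t <;> cases word B'.outWord ts <;> simp
  refine ⟨B', Set.ext fun t => ?_⟩
  rw [mem_language, mem_language, key]
  constructor
  · rintro ⟨i, hi, ht⟩
    exact ⟨g i, hi, by rw [ht]; rfl⟩
  · rintro ⟨q, hq, ht⟩
    obtain ⟨i, hi, rfl⟩ := Option.map_eq_some_iff.1 ht
    exact ⟨i, hq, hi⟩

theorem isRegular_δ {α Q : Type} (A : SDTA α Q) (q : Q) (a : α) : (A.δ q a).IsRegular := by
  classical
  have := A.finite a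
  let M : DFA (Q ⊕ α) (Option (A.H a)) :=
    { step := fun s x => s.bind fun s => A.step a s x
      start := some (A.init a)
      accept := {s | s.bind (A.out a) = some q} }
  have hM : ∀ w s, M.evalFrom s w = s.bind fun s => w.foldlM (A.step a) s := by
    intro w
    induction w with
    | nil => intro s; cases s <;> rfl
    | cons x w ih =>
      intro s
      cases s with
      | none => exact ih none
      | some s => exact (ih (A.step a s x)).trans (by simp [List.foldlM_cons])
  refine ⟨_, Fintype.ofFinite _, M, ?_⟩
  ext w
  change (M.evalFrom (some (A.init a)) w).bind (A.out a) = some q ↔ _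
  rw [hM]
  rfl

/-- A strongly deterministic automaton as a weakly deterministic one. -/
def toWDTA {α Q : Type} (A : SDTA α Q) : WDTA α Q where
  δ := A.δ
  regular q a := A.isRegular_δ q a
  disjoint a _ _ h := Set.disjoint_left.2 fun w (h₁ : A.outWord a w = _)
    (h₂ : A.outWord a w = _) => h (Option.some_inj.1 (h₁.symm.trans h₂))
  final := A.final

end SDTA

theorem WDTA.exists_sdta {α Q : Type} [Finite Q] (A : WDTA α Q) :
    ∃ B : SDTA α Q, B.δ = A.δ ∧ B.language = A.language := by
  classical
  choose σ hσ M hM using A.regular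
  let B : SDTA α Q :=
    { H := fun a => ∀ q, σ q a
      finite := fun a => inferInstance
      init := fun a q => (M q a).start
      step := fun a s x => some fun q => (M q a).step (s q) x
      out := fun a s => if h : ∃ q, s q ∈ (M q a).accept then some h.choose else none
      final := A.final }
  have hrun : ∀ a w (s : B.H a),
      w.foldlM (B.step a) s = some fun q => (M q a).evalFrom (s q) w := by
    intro a w
    induction w with
    | nil => intro s; rfl
    | cons x w ih => intro s; exact ih _
  have hδ : B.δ = A.δ := by
    funext q a
    ext w
    have hacc : ∀ q, w ∈ A.δ q a ↔ (M q a).evalFrom (M q a).start w ∈ (M q a).accept :=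
      fun q => by rw [← hM]; rfl
    rw [SDTA.mem_δ, SDTA.outWord, SDTA.run, hrun, hacc]
    simp only [Option.bind_some, B]
    constructor
    · intro h
      split_ifs at h with h'
      obtain rfl := Option.some_inj.1 h
      exact h'.choose_spec
    · intro h
      have h' : ∃ q, (M q a).evalFrom (M q a).start w ∈ (M q a).accept := ⟨q, h⟩
      rw [dif_pos h', Option.some_inj]
      by_contra hne
      exact Set.disjoint_left.1 (A.disjoint a _ _ hne) ((hacc _).2 h'.choose_spec) ((hacc q).2 h)
  exact ⟨B, hδ, by rw [SDTA.language, WDTA.language, hδ]⟩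

namespace SDTA

variable {α Q₁ Q₂ : Type}

/-- The output of an automaton on words of states. -/
def outStates {α Q : Type} (A : SDTA α Q) (a : α) (w : List Q) : Option Q :=
  A.outWord a (w.map Sum.inl)

theorem run_append {α Q : Type} (A : SDTA α Q) (a : α) (u v : List (Q ⊕ α)) :
    A.run a (u ++ v) = (A.run a u).bind fun s => v.foldlM (A.step a) s := by
  simp [run, List.foldlM_append]

/-- The horizontal states of the automaton for the concatenation, apart from the initial one: the
state of `A₁`, its states after undoing a graft, and the state of `A₂`. -/
abbrev GraftState (A₁ : SDTA α Q₁) (A₂ : SDTA α Q₂) (a : α) : Type :=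
  Option (A₁.H a) × Set (A₁.H a) × Option (A₂.H a)

/-- The horizontal state reached after the siblings `ts` below an `a`-labelled node. -/
def graftState (A₁ : SDTA α Q₁) (A₂ : SDTA α Q₂) (a : α) (ts : List (UTree α)) :
    GraftState A₁ A₂ a :=
  ((pureWord A₁.outStates ts).bind fun w => A₁.run a (w.map Sum.inl),
    {s | ∃ w ∈ graftWords A₁.outStates A₂.language ts, A₁.run a (w.map Sum.inl) = some s},
    (word A₂.outWord ts).bind (A₂.run a))

/-- The next horizontal state after a tree with state `p` in `A₁`, states `S` in `A₁` after undoing a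
graft, and read as `x` by `A₂`. -/
def nextGraftState (A₁ : SDTA α Q₁) (A₂ : SDTA α Q₂) (a : α) (y : GraftState A₁ A₂ a)
    (p : Option Q₁) (S : Set Q₁) (x : Option (Q₂ ⊕ α)) : GraftState A₁ A₂ a :=
  (y.1.bind fun s => p.bind fun p => A₁.step a s (Sum.inl p),
    {s' | (∃ s ∈ y.2.1, ∃ q, p = some q ∧ A₁.step a s (Sum.inl q) = some s') ∨
      ∃ s, y.1 = some s ∧ ∃ q ∈ S, A₁.step a s (Sum.inl q) = some s'},
    y.2.2.bind fun s => x.bind fun x => A₂.step a s x)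

theorem graftState_append (A₁ : SDTA α Q₁) (A₂ : SDTA α Q₂) (a : α) (ts : List (UTree α))
    (t : UTree α) :
    graftState A₁ A₂ a (ts ++ [t]) = nextGraftState A₁ A₂ a (graftState A₁ A₂ a ts)
      (pureValue A₁.outStates t) (graftValues A₁.outStates A₂.language t)
      (letter (value A₂.outWord t) t) := by
  refine Prod.ext ?_ (Prod.ext ?_ ?_)
  · simp only [graftState, nextGraftState, pureWord_append]
    cases pureWord A₁.outStates ts <;> cases h : pureValue A₁.outStates t <;>
      simp [pureWord, h, run_append]
  · ext s'
    simp only [graftState, nextGraftState, mem_graftWords_append, mem_graftWords_singleton,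
      Set.mem_ofPred_eq]
    constructor
    · rintro ⟨_, ⟨u, hu, v, hv, rfl⟩ | ⟨u, hu, _, ⟨q, hq, rfl⟩, rfl⟩, hs⟩
      · cases h : pureValue A₁.outStates t with
        | none => simp [pureWord, h] at hv
        | some q =>
          obtain rfl : [q] = v := by simpa [pureWord, h] using hv
          rw [List.map_append, run_append, Option.bind_eq_some_iff] at hs
          obtain ⟨s, hs, hs'⟩ := hs
          exact Or.inl ⟨s, ⟨u, hu, hs⟩, q, rfl, by simpa using hs'⟩
      · rw [List.map_append, run_append, Option.bind_eq_some_iff] at hs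
        obtain ⟨s, hs, hs'⟩ := hs
        exact Or.inr ⟨s, by simp [hu, hs], q, hq, by simpa using hs'⟩
    · rintro (⟨s, ⟨u, hu, hs⟩, q, hq, hs'⟩ | ⟨s, hs, q, hq, hs'⟩)
      · exact ⟨u ++ [q], Or.inl ⟨u, hu, [q], by simp [pureWord, hq], rfl⟩,
          by simp [run_append, hs, hs']⟩
      · obtain ⟨u, hu, hs⟩ := Option.bind_eq_some_iff.1 hs
        exact ⟨u ++ [q], Or.inr ⟨u, hu, [q], ⟨q, hq, rfl⟩, rfl⟩, by simp [run_append, hs, hs']⟩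
  · simp only [graftState, nextGraftState, word_append]
    cases word A₂.outWord ts <;> cases h : letter (value A₂.outWord t) t <;>
      simp [word, h, run_append]

theorem nextGraftState_none (A₁ : SDTA α Q₁) (A₂ : SDTA α Q₂) (a : α) (y : GraftState A₁ A₂ a) :
    nextGraftState A₁ A₂ a y none ∅ none = (none, ∅, none) := by
  rcases y with ⟨_ | _, _, _ | _⟩ <;> simp [nextGraftState]

theorem nextGraftState_of_none (A₁ : SDTA α Q₁) (A₂ : SDTA α Q₂) (a : α) (p : Option Q₁)
    (S : Set Q₁) (x : Option (Q₂ ⊕ α)) :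
    nextGraftState A₁ A₂ a (none, ∅, none) p S x = (none, ∅, none) := by
  simp [nextGraftState]

/-- The triple of states computed at an `a`-labelled node from its horizontal state. -/
def graftOut (A₁ : SDTA α Q₁) (A₂ : SDTA α Q₂) (a : α) (y : GraftState A₁ A₂ a) :
    Option Q₁ × Set Q₁ × Option Q₂ :=
  (y.1.bind (A₁.out a),
    {q | ((∃ r ∈ A₂.final, y.2.2.bind (A₂.out a) = some r) ∧ ∃ b, A₁.outStates b [] = some q) ∨
      ∃ s ∈ y.2.1, A₁.out a s = some q},
    y.2.2.bind (A₂.out a))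

/-- The triple of states that the automaton for the concatenation computes at a tree. -/
def graftTriple (A₁ : SDTA α Q₁) (A₂ : SDTA α Q₂) (t : UTree α) :
    Option Q₁ × Set Q₁ × Option Q₂ :=
  (pureValue A₁.outStates t, graftValues A₁.outStates A₂.language t, value A₂.outWord t)

theorem graftOut_graftState (A₁ : SDTA α Q₁) (A₂ : SDTA α Q₂) (a : α) (ts : List (UTree α)) :
    graftOut A₁ A₂ a (graftState A₁ A₂ a ts) = graftTriple A₁ A₂ (node a ts) := by
  have h₂ : ((word A₂.outWord ts).bind (A₂.run a)).bind (A₂.out a) =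
      value A₂.outWord (node a ts) := by
    rw [value, Option.bind_assoc]
    rfl
  refine Prod.ext ?_ (Prod.ext ?_ h₂)
  · simp only [graftOut, graftState, graftTriple, pureValue, Option.bind_assoc]
    rfl
  · ext q
    simp only [graftOut, graftState, graftTriple, h₂, Set.mem_ofPred_eq, mem_graftValues_node,
      mem_language]
    refine or_congr Iff.rfl ⟨?_, ?_⟩
    · rintro ⟨s, ⟨w, hw, hs⟩, hq⟩
      exact ⟨w, hw, by rw [outStates, outWord, hs, Option.bind_some, hq]⟩
    · rintro ⟨w, hw, hq⟩
      obtain ⟨s, hs, hq⟩ := Option.bind_eq_some_iff.1 hq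
      exact ⟨s, ⟨w, hw, hs⟩, hq⟩

open scoped Classical in
/-- The state given to a triple: none if the triple carries no information. -/
noncomputable def graftValue (x : Option Q₁ × Set Q₁ × Option Q₂) :
    Option (Option Q₁ × Set Q₁ × Option Q₂) :=
  if x = (none, ∅, none) then none else some x

/-- The next horizontal state of the automaton for the concatenation after a letter. A leaf without
a state in `A₂` carries no state, so that its label remains visible to `A₂`. -/
def nextLetter (A₁ : SDTA α Q₁) (A₂ : SDTA α Q₂) (a : α) (y : GraftState A₁ A₂ a) :
    (Option Q₁ × Set Q₁ × Option Q₂) ⊕ α → GraftState A₁ A₂ a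
  | Sum.inl x => nextGraftState A₁ A₂ a y x.1 x.2.1 (x.2.2.map Sum.inl)
  | Sum.inr b => nextGraftState A₁ A₂ a y (A₁.outStates b []) ∅ (some (Sum.inr b))

open scoped Classical in
/-- An automaton for the concatenation `L(A₂) · L(A₁)`. -/
noncomputable def concatenation [Finite Q₁] (A₁ : SDTA α Q₁) (A₂ : SDTA α Q₂) :
    SDTA α (Option Q₁ × Set Q₁ × Option Q₂) where
  H a := Option (GraftState A₁ A₂ a)
  finite a := by
    have := A₁.finite a
    have := A₂.finite a
    infer_instance
  init a := none
  step a y x := some (some (nextLetter A₁ A₂ a (y.getD (graftState A₁ A₂ a [])) x))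
  out a
    | none => if value A₂.outWord (node a []) = none then none else
        graftValue (graftOut A₁ A₂ a (graftState A₁ A₂ a []))
    | some y => graftValue (graftOut A₁ A₂ a y)
  final := {x | ∃ q ∈ A₁.final, q ∈ x.2.1}

theorem concatenation_run [Finite Q₁] (A₁ : SDTA α Q₁) (A₂ : SDTA α Q₂) (a : α) {x}
    (w : List ((Option Q₁ × Set Q₁ × Option Q₂) ⊕ α)) :
    (concatenation A₁ A₂).run a (x :: w) =
      some (some ((x :: w).foldl (nextLetter A₁ A₂ a) (graftState A₁ A₂ a []))) := by
  have h : ∀ (w : List ((Option Q₁ × Set Q₁ × Option Q₂) ⊕ α)) y,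
      w.foldlM ((concatenation A₁ A₂).step a) (some y) =
        some (some (w.foldl (nextLetter A₁ A₂ a) y)) := by
    intro w
    induction w with
    | nil => intro y; rfl
    | cons x w ih => intro y; exact ih _
  exact h w _

/-- The automaton for the concatenation computes the right state at `t`. -/
def ConcatenationSpec [Finite Q₁] (A₁ : SDTA α Q₁) (A₂ : SDTA α Q₂) (t : UTree α) : Prop :=
  value (concatenation A₁ A₂).outWord t = graftValue (graftTriple A₁ A₂ t) ∨
    ∃ b, t = node b [] ∧ value A₂.outWord t = none ∧
      value (concatenation A₁ A₂).outWord t = none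

theorem graftValues_leaf (A₁ : SDTA α Q₁) (A₂ : SDTA α Q₂) {b : α}
    (h : value A₂.outWord (node b []) = none) :
    graftValues A₁.outStates A₂.language (node b []) = ∅ := by
  ext q
  simp [mem_graftValues_node, graftWords_nil, mem_language, h]

theorem nextGraftState_letter [Finite Q₁] (A₁ : SDTA α Q₁) (A₂ : SDTA α Q₂) {t : UTree α}
    (ht : ConcatenationSpec A₁ A₂ t) (a : α) (y : GraftState A₁ A₂ a) :
    nextGraftState A₁ A₂ a y (pureValue A₁.outStates t)
        (graftValues A₁.outStates A₂.language t) (letter (value A₂.outWord t) t) =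
      ((letter (value (concatenation A₁ A₂).outWord t) t).map (nextLetter A₁ A₂ a y)).getD
        (none, ∅, none) := by
  have leaf : ∀ b, t = node b [] → value A₂.outWord t = none →
      value (concatenation A₁ A₂).outWord t = none →
      nextGraftState A₁ A₂ a y (pureValue A₁.outStates t)
        (graftValues A₁.outStates A₂.language t) (letter (value A₂.outWord t) t) =
      ((letter (value (concatenation A₁ A₂).outWord t) t).map (nextLetter A₁ A₂ a y)).getD
        (none, ∅, none) := by
    rintro b rfl h₂ h
    rw [graftValues_leaf A₁ A₂ h₂, h₂, h]
    simp [letter, nextLetter, pureValue, pureWord]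
  rcases ht with ht | ⟨b, rfl, h₂, h⟩
  · by_cases h0 : graftTriple A₁ A₂ t = (none, ∅, none)
    · rw [h0, graftValue, if_pos rfl] at ht
      simp only [graftTriple, Prod.mk.injEq] at h0
      match t with
      | node b [] => exact leaf b rfl h0.2.2 ht
      | node b (_ :: _) =>
        rw [h0.1, h0.2.1, h0.2.2, ht]
        simp [letter, nextGraftState_none]
    · rw [graftValue, if_neg h0] at ht
      cases h₂ : value A₂.outWord t with
      | some q => rw [ht]; simp [letter, nextLetter, graftTriple, h₂]
      | none =>
        match t with
        | node b [] =>
          rw [value, word, Option.bind_some] at ht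
          have : (concatenation A₁ A₂).outWord b [] = none := by
            change (if value A₂.outWord (node b []) = none then none else _) = none
            rw [if_pos h₂]
          rw [this] at ht
          cases ht
        | node b (_ :: _) => rw [ht]; simp [letter, nextLetter, graftTriple, h₂]
  · exact leaf b rfl h₂ h

theorem graftState_eq [Finite Q₁] (A₁ : SDTA α Q₁) (A₂ : SDTA α Q₂) (a : α) (ts : List (UTree α))
    (h : ∀ t ∈ ts, ConcatenationSpec A₁ A₂ t) :
    graftState A₁ A₂ a ts = ((word (concatenation A₁ A₂).outWord ts).map
      (List.foldl (nextLetter A₁ A₂ a) (graftState A₁ A₂ a []))).getD (none, ∅, none) := by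
  induction ts using List.reverseRecOn with
  | nil => simp [word]
  | append_singleton ts t ih =>
    rw [graftState_append, nextGraftState_letter A₁ A₂ (h t (by simp)),
      ih fun t ht => h t (by simp [ht]), word_append]
    cases hw : word (concatenation A₁ A₂).outWord ts with
    | some w =>
      cases hl : letter (value (concatenation A₁ A₂).outWord t) t <;> simp [word, hl]
    | none =>
      cases hl : letter (value (concatenation A₁ A₂).outWord t) t with
      | none => simp
      | some x => cases x <;> simp [nextLetter, nextGraftState_of_none]

theorem concatenation_spec [Finite Q₁] (A₁ : SDTA α Q₁) (A₂ : SDTA α Q₂) (t : UTree α) :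
    ConcatenationSpec A₁ A₂ t := by
  induction t using UTree.rec (motive_2 := fun ts => ∀ t ∈ ts, ConcatenationSpec A₁ A₂ t) with
  | nil => simp_all
  | cons t ts ht hts =>
    rename_i s hs
    rcases List.mem_cons.1 hs with rfl | hs
    exacts [ht, hts s hs]
  | node a ts ih =>
    have hs := graftState_eq A₁ A₂ a ts ih
    rw [ConcatenationSpec, ← graftOut_graftState, value]
    match ts with
    | [] =>
      have : (word (concatenation A₁ A₂).outWord []).bind ((concatenation A₁ A₂).outWord a) =
          if value A₂.outWord (node a []) = none then none else
            graftValue (graftOut A₁ A₂ a (graftState A₁ A₂ a [])) := by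
        rw [word]
        rfl
      rw [this]
      split_ifs with h
      · exact Or.inr ⟨a, rfl, h, rfl⟩
      · exact Or.inl rfl
    | t :: ts =>
      refine Or.inl ?_
      rw [hs]
      cases hw : word (concatenation A₁ A₂).outWord (t :: ts) with
      | none =>
        have : graftOut A₁ A₂ a (none, ∅, none) = (none, ∅, none) := by simp [graftOut]
        simp [this, graftValue]
      | some w =>
        match w with
        | [] =>
          rw [word] at hw
          simp [Option.bind_eq_some_iff] at hw
        | x :: w =>
          rw [Option.bind_some, outWord, concatenation_run]
          rfl

theorem concatenation_language [Finite Q₁] (A₁ : SDTA α Q₁) (A₂ : SDTA α Q₂)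
    (h : A₁.δ.LeavesCarryStates) :
    (concatenation A₁ A₂).language = concat A₂.language A₁.language := by
  ext t
  rw [mem_language]
  refine Iff.trans ?_ (h.mem_concat_iff (fun q a w => A₁.mem_δ q a _)).symm
  rcases concatenation_spec A₁ A₂ t with ht | ⟨b, rfl, h₂, ht⟩
  · rw [ht, graftValue]
    split_ifs with h0
    · have : graftValues A₁.outStates A₂.language t = ∅ := congrArg (fun x => x.2.1) h0
      change _ ↔ ∃ q ∈ A₁.final, q ∈ graftValues A₁.outStates A₂.language t
      simp [this]
    · constructor
      · rintro ⟨_, ⟨q, hq, hS⟩, hx⟩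
        rw [← Option.some_inj.1 hx] at hS
        exact ⟨q, hq, hS⟩
      · rintro ⟨q, hq, hS⟩
        exact ⟨_, ⟨q, hq, hS⟩, rfl⟩
  · rw [ht]
    have := graftValues_leaf A₁ A₂ h₂
    change _ ↔ ∃ q ∈ A₁.final, q ∈ graftValues A₁.outStates A₂.language (node b [])
    simp [this]

theorem graftTriple_mem (A₁ : SDTA α Q₁) (A₂ : SDTA α Q₂) {q₀ : Q₁} {f : Q₂} {b : α}
    (hb : A₁.outStates b [] = some q₀) (hf : f ∈ A₂.final) {t : UTree α}
    (h0 : graftTriple A₁ A₂ t ≠ (none, ∅, none)) : graftTriple A₁ A₂ t ∈ graftTriples q₀ f := by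
  refine ⟨h0, fun h => ?_⟩
  cases t with
  | node a ts => exact mem_graftValues_node.2 (Or.inl ⟨mem_language.2 ⟨f, hf, h⟩, b, hb⟩)

theorem pureValue_eq_none {f : α → List Q₁ → Option Q₁} (h : ∀ b, f b [] = none) (t : UTree α) :
    pureValue f t = none := by
  induction t using UTree.rec (motive_2 := fun ts => ts ≠ [] → pureWord f ts = none) with
  | nil => contradiction
  | cons t ts ht _ => simp [pureWord, ht]
  | node a ts ih =>
    cases ts with
    | nil => simp [pureValue, pureWord, h]
    | cons t ts => simp [pureValue, ih]

theorem exists_concatenation [Fintype Q₁] [Fintype Q₂] (A₁ : SDTA α Q₁) (A₂ : SDTA α Q₂)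
    (h : A₁.δ.LeavesCarryStates) :
    ∃ k : ℕ, k ≤ (Fintype.card Q₁ + 1) *
          (2 ^ Fintype.card Q₁ * (Fintype.card Q₂ + 1) - 2 ^ (Fintype.card Q₁ - 1)) - 1 ∧
      ∃ B : SDTA α (Fin k), B.language = concat A₂.language A₁.language := by
  by_cases hq : ∃ q₀ b, A₁.outStates b [] = some q₀
  · by_cases hf : ∃ f, f ∈ A₂.final
    · obtain ⟨q₀, b, hb⟩ := hq
      obtain ⟨f, hf⟩ := hf
      refine ⟨_, (ncard_graftTriples q₀ f).le, ?_⟩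
      rw [← concatenation_language A₁ A₂ h]
      refine exists_fin _ (Set.toFinite _) fun t x hx => ?_
      rcases concatenation_spec A₁ A₂ t with ht | ⟨b, rfl, h₂, ht⟩
      · rw [hx, graftValue] at ht
        split_ifs at ht with h0
        rw [Option.some_inj.1 ht]
        exact graftTriple_mem A₁ A₂ hb hf h0
      · rw [hx] at ht
        cases ht
    · refine ⟨0, Nat.zero_le _, ⟨fun _ => Unit, fun _ => inferInstance, fun _ => (),
        fun _ _ _ => none, fun _ _ => none, ∅⟩, ?_⟩
      ext t
      rw [mem_language]
      simp only [concat, mem_language]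
      simp only [not_exists] at hf
      simp [hf]
  · refine ⟨0, Nat.zero_le _, ⟨fun _ => Unit, fun _ => inferInstance, fun _ => (),
      fun _ _ _ => none, fun _ _ => none, ∅⟩, ?_⟩
    ext t
    rw [mem_language]
    refine Iff.trans ?_ (h.mem_concat_iff (fun q a w => A₁.mem_δ q a _)).symm
    have : ∀ t, pureValue A₁.outStates t = none := pureValue_eq_none fun b => by
      rw [Option.eq_none_iff_forall_ne_some]
      exact fun q hb => hq ⟨q, b, hb⟩
    change _ ↔ ∃ q ∈ A₁.final, q ∈ graftValues A₁.outStates A₂.language t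
    simp [graftValues, this]

end SDTA

/-- The partial function `f` on words, restricted to words of length at most `N`. -/
def truncate {α β γ : Type} (N : ℕ) (f : α → List β → Option γ) (a : α) (w : List β) :
    Option γ :=
  if w.length ≤ N then f a w else none

open scoped Classical in
/-- A partial function on words of states as a function that is undefined at words that contain
labels. -/
noncomputable def onStates {α Q : Type} (f : α → List Q → Option Q) (a : α)
    (w : List (Q ⊕ α)) : Option Q :=
  if ∀ b, Sum.inr b ∉ w then f a (w.filterMap Sum.getLeft?) else none

theorem onStates_map_inl {α Q : Type} (f : α → List Q → Option Q) (a : α) (w : List Q) :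
    onStates f a (w.map Sum.inl) = f a w := by
  rw [onStates, if_pos (by simp), List.filterMap_map]
  congr 1
  exact List.filterMap_some

namespace SDTA

/-- The strongly deterministic automaton whose output is a given function on words of length at most
`N` and undefined on longer words. -/
def ofBounded {α Q : Type} [Finite α] [Finite Q] (N : ℕ) (out : α → List (Q ⊕ α) → Option Q)
    (F : Set Q) : SDTA α Q where
  H _ := {w : List (Q ⊕ α) // w.length ≤ N}
  finite _ := List.finite_length_le _ N
  init _ := ⟨[], Nat.zero_le N⟩
  step _ w x := if h : (w.1 ++ [x]).length ≤ N then some ⟨w.1 ++ [x], h⟩ else none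
  out a w := out a w.1
  final := F

theorem ofBounded_outWord {α Q : Type} [Finite α] [Finite Q] (N : ℕ)
    (out : α → List (Q ⊕ α) → Option Q) (F : Set Q) :
    (ofBounded N out F).outWord = truncate N out := by
  have h : ∀ (a : α) (w : List (Q ⊕ α)) (u : (ofBounded N out F).H a),
      (w.foldlM ((ofBounded N out F).step a) u).bind ((ofBounded N out F).out a) =
        truncate N out a (u.1 ++ w) := by
    intro a w
    induction w with
    | nil =>
      intro u
      rw [truncate, if_pos (by simpa using u.2), List.append_nil]
      rfl
    | cons x w ih =>
      intro u
      rw [List.foldlM_cons]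
      by_cases hu : (u.1 ++ [x]).length ≤ N
      · have : (ofBounded N out F).step a u x = some ⟨u.1 ++ [x], hu⟩ := dif_pos hu
        rw [this]
        exact (ih _).trans (by simp)
      · have : (ofBounded N out F).step a u x = none := dif_neg hu
        rw [this, truncate, if_neg]
        · rfl
        · simp only [List.length_append, List.length_cons, List.length_nil] at hu ⊢
          omega
  funext a w
  exact h a w _

theorem ofBounded_onStates_leavesCarryStates {α Q : Type} [Finite α] [Finite Q] (N : ℕ)
    (f : α → List Q → Option Q) (F : Set Q) :
    (ofBounded N (onStates f) F).δ.LeavesCarryStates := by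
  intro q b w a hw ha
  rw [mem_δ, ofBounded_outWord, truncate, onStates] at hw
  split_ifs at hw with h₁ h₂
  exact absurd ha (h₂ a)

end SDTA

/-- The labels of the trees for which the bound on the concatenation is attained. -/
inductive Label
  | point | num | ins | del | mark | test | aux
  deriving DecidableEq

instance : Fintype Label :=
  ⟨{.point, .num, .ins, .del, .mark, .test, .aux}, fun x => by cases x <;> decide⟩

namespace Label

/-- The states of the automaton whose leaves are replaced. -/
def state (n : ℕ) [NeZero n] : Label → List (Fin n) → Option (Fin n)
  | point, [] => some 0
  | num, w => some (Fin.ofNat n w.length)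
  | ins, s :: v :: w => some (if v = 0 then Fin.ofNat n w.length else s)
  | del, s :: v :: w => if v = 0 then some (Fin.ofNat n w.length) else
      if s = Fin.ofNat n w.length then none else some s
  | mark, [_] => some (Fin.ofNat n (n - 1))
  | test, s :: _ :: w => if s = Fin.ofNat n w.length then some 0 else none
  | _, _ => none

/-- The states of the automaton for the grafted trees. -/
def graftedState (m n : ℕ) [NeZero m] : Label → List (Fin m ⊕ Label) → Option (Fin m)
  | num, w => if h : w.length / n - 1 < m then
      if w.length / n = 0 then none else some ⟨w.length / n - 1, h⟩ else none
  | ins, Sum.inl q :: _ => some q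
  | del, Sum.inl q :: _ => some q
  | mark, [Sum.inr _] => some 0
  | aux, [] => some 0
  | aux, [Sum.inl q] => some q
  | aux, Sum.inl q :: Sum.inr _ :: w => if q.val = w.length then some 0 else none
  | _, _ => none

/-- A bound on the lengths of the horizontal words. -/
def bound (m n : ℕ) : ℕ := n * (m + 2) + m + n + 2

variable (m n : ℕ) [NeZero m] [NeZero n]

/-- `state`, restricted to short words. -/
def shortState : Label → List (Fin n) → Option (Fin n) := truncate (bound m n) (state n)

/-- `graftedState`, restricted to short words. -/
def shortGraftedState : Label → List (Fin m ⊕ Label) → Option (Fin m) :=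
  truncate (bound m n) (graftedState m n)

/-- The set of grafted trees. -/
def grafted : Set (UTree Label) := {t | value (shortGraftedState m n) t = some 0}

/-- The triple consisting of the state of a tree, its states after undoing a graft, and its state as a
grafted tree. -/
def triple (t : UTree Label) : Option (Fin n) × Set (Fin n) × Option (Fin m) :=
  (pureValue (shortState m n) t, graftValues (shortState m n) (grafted m n) t,
    value (shortGraftedState m n) t)

variable {m n}

theorem ofNat_val (j : Fin n) : Fin.ofNat n j.val = j := by
  ext
  simp [Fin.ofNat, Nat.mod_eq_of_lt j.2]

theorem truncate_of_le {α β γ : Type} {N : ℕ} {f : α → List β → Option γ} {a : α} {w : List β}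
    (h : w.length ≤ N) : truncate N f a w = f a w := if_pos h

omit [NeZero m] in
theorem exists_shortState_nil (q : Fin n) : (∃ b, shortState m n b [] = some q) ↔ q = 0 := by
  constructor
  · rintro ⟨b, hb⟩
    rw [shortState, truncate_of_le (Nat.zero_le _)] at hb
    cases b <;> simp_all [state, eq_comm]
  · rintro rfl
    exact ⟨point, by rw [shortState, truncate_of_le (Nat.zero_le _), state]⟩

theorem mem_graftValues {q : Fin n} {a : Label} {ts : List (UTree Label)} :
    q ∈ graftValues (shortState m n) (grafted m n) (node a ts) ↔
      (value (shortGraftedState m n) (node a ts) = some 0 ∧ q = 0) ∨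
      ∃ w ∈ graftWords (shortState m n) (grafted m n) ts, shortState m n a w = some q := by
  rw [mem_graftValues_node, exists_shortState_nil]
  rfl

theorem triple_point : triple m n (node point []) = (some 0, ∅, none) := by
  have h : value (shortGraftedState m n) (node point []) = none := by
    rw [value, word, Option.bind_some, shortGraftedState, truncate_of_le (Nat.zero_le _),
      graftedState] <;> simp
  refine Prod.ext ?_ (Prod.ext ?_ h)
  · simp only [triple, pureValue, pureWord, Option.bind_some]
    rw [shortState, truncate_of_le (Nat.zero_le _), state]
  · ext q
    simp [triple, mem_graftValues, h, graftWords_nil]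

theorem triple_mark :
    triple m n (node mark [node point []]) = (some (Fin.ofNat n (n - 1)), {0}, some 0) := by
  have hp := triple_point (m := m) (n := n)
  simp only [triple, Prod.mk.injEq] at hp
  have hw : word (shortGraftedState m n) [node point []] = some [Sum.inr point] := by
    simp [word, hp, letter]
  have h : value (shortGraftedState m n) (node mark [node point []]) = some 0 := by
    rw [value, hw, Option.bind_some, shortGraftedState,
      truncate_of_le (by simp [bound]), graftedState]
  refine Prod.ext ?_ (Prod.ext ?_ h)
  · simp only [triple, pureValue.eq_1 _ mark, pureWord, hp, Option.bind_some, Option.map_some]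
    rw [shortState, truncate_of_le (by simp [bound]), state]
  · ext q
    simp [triple, mem_graftValues, h, mem_graftWords_singleton, hp]

theorem triple_aux : triple m n (node aux []) = (none, {0}, some 0) := by
  have h : value (shortGraftedState m n) (node aux []) = some 0 := by
    rw [value, word, Option.bind_some, shortGraftedState, truncate_of_le (Nat.zero_le _),
      graftedState]
  refine Prod.ext ?_ (Prod.ext ?_ h)
  · simp only [triple, pureValue, pureWord, Option.bind_some]
    rw [shortState, truncate_of_le (Nat.zero_le _), state] <;> simp
  · ext q
    simp [triple, mem_graftValues, h, graftWords_nil]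

/-- The tree that combines `x`, `y` and `j` leaves. -/
def join (a : Label) (x y : UTree Label) (j : ℕ) : UTree Label :=
  node a (x :: y :: List.replicate j (node point []))

theorem pureValue_join {a : Label} {x y : UTree Label} {j : ℕ} (hj : j ≤ m + n) :
    pureValue (shortState m n) (join a x y j) = (pureValue (shortState m n) x).bind fun s =>
      (pureValue (shortState m n) y).bind fun v => state n a (s :: v :: List.replicate j 0) := by
  have hp := pureWord_replicate (shortState m n) (congrArg Prod.fst (triple_point (m := m) (n := n))) j
  simp only [join, pureValue.eq_1 _ a, pureWord, hp]
  cases pureValue (shortState m n) x <;> cases pureValue (shortState m n) y <;> simp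
  rw [shortState, truncate_of_le]
  simp [bound]
  omega

theorem value_join {a : Label} {x y : UTree Label} {j : ℕ} (hj : j ≤ m + n) :
    value (shortGraftedState m n) (join a x y j) =
      (letter (value (shortGraftedState m n) x) x).bind fun s =>
      (letter (value (shortGraftedState m n) y) y).bind fun v =>
        graftedState m n a (s :: v :: List.replicate j (Sum.inr point)) := by
  have hp := congrArg (fun x => x.2.2) (triple_point (m := m) (n := n))
  have hp := word_replicate (shortGraftedState m n) (t := node point []) (x := Sum.inr point)
    (by simp only [triple] at hp; rw [hp, letter]) j
  simp only [join, value.eq_1 _ a, word, hp]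
  cases letter (value (shortGraftedState m n) x) x <;>
    cases letter (value (shortGraftedState m n) y) y <;> simp
  rw [shortGraftedState, truncate_of_le]
  simp [bound]
  omega

theorem mem_graftValues_join {a : Label} {x y : UTree Label} {j : ℕ} (hj : j ≤ m + n) {q : Fin n} :
    q ∈ graftValues (shortState m n) (grafted m n) (join a x y j) ↔
      (value (shortGraftedState m n) (join a x y j) = some 0 ∧ q = 0) ∨
      (∃ s ∈ graftValues (shortState m n) (grafted m n) x,
        ∃ v, pureValue (shortState m n) y = some v ∧
          state n a (s :: v :: List.replicate j 0) = some q) ∨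
      ∃ s, pureValue (shortState m n) x = some s ∧
        ∃ v ∈ graftValues (shortState m n) (grafted m n) y,
          state n a (s :: v :: List.replicate j 0) = some q := by
  have h₁ := pureWord_replicate (shortState m n) (congrArg Prod.fst (triple_point (m := m) (n := n))) j
  have h₂ : graftWords (shortState m n) (grafted m n) (List.replicate j (node point [])) = ∅ :=
    graftWords_replicate (congrArg (fun x => x.2.1) (triple_point (m := m) (n := n))) j
  have h₃ : ∀ s v, shortState m n a (s :: v :: List.replicate j 0) =
      state n a (s :: v :: List.replicate j 0) := by
    intro s v
    rw [shortState, truncate_of_le]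
    simp [bound]
    omega
  rw [join, mem_graftValues]
  refine or_congr Iff.rfl ?_
  simp only [mem_graftWords_cons, h₁, h₂, pureWord]
  constructor
  · rintro ⟨_, ⟨s, hs, v, hv, rfl⟩ | ⟨s, hs, v, ⟨r, hr, u, hu, rfl⟩ | ⟨r, hr, u, hu, rfl⟩, rfl⟩, hq⟩
    · obtain ⟨r, hr, hv⟩ := Option.bind_eq_some_iff.1 hv
      obtain rfl := Option.some_inj.1 hv
      exact Or.inl ⟨s, hs, r, hr, by rw [← h₃, hq]⟩
    · obtain rfl := Option.some_inj.1 hu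
      exact Or.inr ⟨s, hs, r, hr, by rw [← h₃, hq]⟩
    · exact hu.elim
  · rintro (⟨s, hs, v, hv, hq⟩ | ⟨s, hs, v, hv, hq⟩)
    · exact ⟨_, Or.inl ⟨s, hs, _, by rw [hv]; rfl, rfl⟩, by rw [h₃, hq]⟩
    · exact ⟨_, Or.inr ⟨s, hs, _, Or.inl ⟨v, hv, _, rfl, rfl⟩, rfl⟩, by rw [h₃, hq]⟩

theorem letter_of_ne {α Q : Type} {t : UTree α} (ht : ∀ b, t ≠ node b []) (v : Option Q) :
    letter v t = v.map Sum.inl := by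
  match t, v with
  | _, some q => rfl
  | node b [], none => exact absurd rfl (ht b)
  | node b (_ :: _), none => rfl

theorem join_ne (a : Label) (x y : UTree Label) (j : ℕ) (b : Label) : join a x y j ≠ node b [] := by
  simp [join]

theorem exists_triple_num (p : Fin n) (q : Option (Fin m)) :
    ∃ t, (∀ b, t ≠ node b []) ∧ triple m n t = (some p, {r | q = some 0 ∧ r = 0}, q) := by
  obtain ⟨k, hk, hq⟩ : ∃ k ≤ m, ∀ j, j / n = k + 1 →
      (if h : j / n - 1 < m then if j / n = 0 then none else some ⟨j / n - 1, h⟩ else none) = q := by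
    cases q with
    | none => exact ⟨m, le_rfl, fun j hj => by simp [hj]⟩
    | some q => exact ⟨q, q.2.le, fun j hj => by simp [hj]⟩
  have hn : 0 < n := Nat.pos_of_neZero n
  have hl : p + n * (k + 1) ≤ bound m n := by
    have h : n * (k + 1) ≤ n * (m + 1) := Nat.mul_le_mul le_rfl (by omega)
    have := p.2
    rw [Nat.mul_add n m 1] at h
    rw [bound, Nat.mul_add n m 2]
    omega
  have hd : (p + n * (k + 1)) / n = k + 1 := by
    rw [Nat.add_mul_div_left _ _ hn, Nat.div_eq_of_lt p.2, zero_add]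
  have hp := triple_point (m := m) (n := n)
  simp only [triple, Prod.mk.injEq] at hp
  have h : value (shortGraftedState m n)
      (node num (List.replicate (p + n * (k + 1)) (node point []))) = q := by
    rw [value, word_replicate _ (x := Sum.inr point) (by rw [hp.2.2, letter]), Option.bind_some,
      shortGraftedState, truncate_of_le (by simpa using hl), graftedState]
    simp only [List.length_replicate]
    exact hq _ hd
  refine ⟨node num (List.replicate (p + n * (k + 1)) (node point [])), ?_, ?_⟩
  · intro b hb
    injection hb with _ hb
    have := congrArg List.length hb
    simp only [List.length_replicate, List.length_nil] at this
    rw [this] at hd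
    simp at hd
  · refine Prod.ext ?_ (Prod.ext ?_ h)
    · simp only [triple]
      rw [pureValue, pureWord_replicate _ hp.1, Option.bind_some,
        shortState, truncate_of_le (by simpa using hl), state]
      simp [Fin.ofNat, Nat.mod_eq_of_lt p.2]
    · ext r
      simp only [triple, mem_graftValues, h, graftWords_replicate hp.2.1]
      simp

theorem triple_ins {t : UTree Label} (ht : ∀ b, t ≠ node b []) {p : Fin n} {S : Set (Fin n)}
    {q : Option (Fin m)} (h : triple m n t = (some p, S, q)) (hq : q = some 0 → 0 ∈ S) (i : Fin n) :
    triple m n (join ins t (node mark [node point []]) i) = (some p, insert i S, q) := by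
  have hi : (i : ℕ) ≤ m + n := by omega
  have hm := triple_mark (m := m) (n := n)
  simp only [triple, Prod.mk.injEq] at h hm
  have hs : ∀ s : Fin n, state n ins (s :: Fin.ofNat n (n - 1) :: List.replicate i 0) = some s := by
    intro s
    simp only [state, List.length_replicate, ofNat_val, Option.some_inj, ite_eq_right_iff]
    intro h0
    obtain rfl : n = 1 := by
      have := congrArg Fin.val h0
      simp only [Fin.ofNat, Fin.val_zero] at this
      rw [Nat.mod_eq_of_lt (by omega)] at this
      have := Nat.pos_of_neZero n
      omega
    exact Subsingleton.elim _ _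
  have h₂ : value (shortGraftedState m n) (join ins t (node mark [node point []]) i) = q := by
    rw [value_join hi, letter_of_ne ht, hm.2.2, h.2.2]
    cases q <;> simp [letter, graftedState]
  refine Prod.ext ?_ (Prod.ext ?_ h₂)
  · exact (pureValue_join hi).trans (by rw [h.1, hm.1, Option.bind_some, Option.bind_some, hs])
  · ext r
    simp only [triple, mem_graftValues_join hi, h₂, h, hm, Option.some_inj, exists_eq_left', hs,
      Set.mem_singleton_iff, exists_eq_left, Set.mem_insert_iff]
    simp only [state, List.length_replicate, ofNat_val, if_true, Option.some_inj, exists_eq_right]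
    constructor
    · rintro (⟨h0, rfl⟩ | h | rfl)
      · exact Or.inr (hq h0)
      · exact Or.inr h
      · exact Or.inl rfl
    · rintro (rfl | h)
      · exact Or.inr (Or.inr rfl)
      · exact Or.inr (Or.inl h)

theorem exists_triple_some (p : Fin n) {S : Set (Fin n)} {q : Option (Fin m)}
    (hq : q = some 0 → 0 ∈ S) :
    ∃ t, (∀ b, t ≠ node b []) ∧ triple m n t = (some p, S, q) := by
  have key : ∀ T : Finset (Fin n), ∃ t, (∀ b, t ≠ node b []) ∧
      triple m n t = (some p, ↑T ∪ {r | q = some 0 ∧ r = 0}, q) := by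
    intro T
    induction T using Finset.induction_on with
    | empty => simpa using exists_triple_num p q
    | insert i T _ ih =>
      obtain ⟨t, ht, h⟩ := ih
      refine ⟨_, join_ne _ _ _ _, (triple_ins ht h (fun h => ?_) i).trans ?_⟩
      · exact Or.inr ⟨h, rfl⟩
      · rw [Finset.coe_insert, Set.insert_union]
  obtain ⟨t, ht, h⟩ := key (Set.toFinite S).toFinset
  refine ⟨t, ht, h.trans ?_⟩
  rw [Set.Finite.coe_toFinset, Set.union_eq_left.2]
  rintro r ⟨h, rfl⟩
  exact hq h

theorem exists_triple_none {S : Set (Fin n)} {q : Option (Fin m)} (hq : q = some 0 → 0 ∈ S)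
    {j : Fin n} (hj : j ∈ S) :
    ∃ t, (∀ b, t ≠ node b []) ∧ triple m n t = (none, S, q) := by
  obtain ⟨t, ht, h⟩ := exists_triple_some j hq
  have hi : (j : ℕ) ≤ m + n := by omega
  have hm := triple_mark (m := m) (n := n)
  have ha := triple_aux (m := m) (n := n)
  simp only [triple, Prod.mk.injEq] at h hm ha
  have hs₀ : ∀ s : Fin n, state n del (s :: 0 :: List.replicate j 0) = some j := by
    simp [state]
  by_cases hn : n = 1
  · subst hn
    have h₂ : value (shortGraftedState m 1) (join del t (node aux []) j) = q := by
      rw [value_join hi, letter_of_ne ht, ha.2.2, h.2.2]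
      cases q <;> simp [letter, graftedState]
    refine ⟨join del t (node aux []) j, join_ne _ _ _ _, Prod.ext ?_ (Prod.ext ?_ h₂)⟩
    · exact (pureValue_join hi).trans (by rw [h.1, ha.1]; rfl)
    · ext r
      obtain rfl : r = j := Subsingleton.elim _ _
      simp only [hj, iff_true]
      exact (mem_graftValues_join hi).2 (Or.inr (Or.inr ⟨r, h.1, 0, by simp [ha], hs₀ r⟩))
  · have hs : ∀ s : Fin n, state n del (s :: Fin.ofNat n (n - 1) :: List.replicate j 0) =
        if s = j then none else some s := by
      intro s
      have : Fin.ofNat n (n - 1) ≠ 0 := by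
        intro h0
        have := congrArg Fin.val h0
        simp only [Fin.ofNat, Fin.val_zero] at this
        rw [Nat.mod_eq_of_lt (by omega)] at this
        have := Nat.pos_of_neZero n
        omega
      simp only [state, List.length_replicate, ofNat_val, if_neg this]
    have h₂ : value (shortGraftedState m n) (join del t (node mark [node point []]) j) = q := by
      rw [value_join hi, letter_of_ne ht, hm.2.2, h.2.2]
      cases q <;> simp [letter, graftedState]
    refine ⟨join del t (node mark [node point []]) j, join_ne _ _ _ _,
      Prod.ext ?_ (Prod.ext ?_ h₂)⟩
    · exact (pureValue_join hi).trans
        (by rw [h.1, hm.1, Option.bind_some, Option.bind_some, hs, if_pos rfl])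
    · ext r
      simp only [triple, mem_graftValues_join hi, h₂, h, hm, Option.some_inj, exists_eq_left', hs,
        Set.mem_singleton_iff, exists_eq_left, hs₀]
      constructor
      · rintro (⟨h0, rfl⟩ | ⟨s, hs, h⟩ | rfl)
        · exact hq h0
        · split_ifs at h
          rwa [← Option.some_inj.1 h]
        · exact hj
      · intro hr
        by_cases hrj : r = j
        · exact Or.inr (Or.inr hrj.symm)
        · exact Or.inr (Or.inl ⟨r, hr, if_neg hrj⟩)

theorem exists_triple_empty {q : Fin m} (hq : q ≠ 0) :
    ∃ t, (∀ b, t ≠ node b []) ∧ triple m n t = (none, ∅, some q) := by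
  obtain ⟨t, ht, h⟩ := exists_triple_some (S := ∅) (0 : Fin n) (q := some q) (by simp [hq])
  simp only [triple, Prod.mk.injEq] at h
  have hs : ∀ w, shortState m n aux w = none := fun w => by
    rw [shortState, truncate]
    split_ifs
    · rw [state] <;> simp
    · rfl
  have h₂ : value (shortGraftedState m n) (node aux [t]) = some q := by
    rw [value, word, letter_of_ne ht, h.2.2, word]
    simp only [Option.map_some, Option.bind_some]
    rw [shortGraftedState, truncate_of_le (by simp [bound]), graftedState]
  refine ⟨node aux [t], by simp, Prod.ext ?_ (Prod.ext ?_ h₂)⟩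
  · simp only [triple, pureValue.eq_1 _ aux]
    cases pureWord (shortState m n) [t] <;> simp [hs]
  · ext r
    simp [triple, mem_graftValues, h₂, hq, hs]

theorem exists_triple {x : Option (Fin n) × Set (Fin n) × Option (Fin m)}
    (hx : x ∈ graftTriples 0 0) : ∃ t, (∀ b, t ≠ node b []) ∧ triple m n t = x := by
  obtain ⟨p, S, q⟩ := x
  obtain ⟨h0, hq⟩ := hx
  cases p with
  | some p => exact exists_triple_some p hq
  | none =>
    rcases S.eq_empty_or_nonempty with rfl | ⟨j, hj⟩
    · cases q with
      | none => exact absurd rfl h0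
      | some q => exact exists_triple_empty fun h => hq (congrArg some h)
    · exact exists_triple_none hq hj

theorem zero_mem_test_point {t : UTree Label} (j : Fin n) :
    0 ∈ graftValues (shortState m n) (grafted m n) (join test t (node point []) j) ↔
      j ∈ graftValues (shortState m n) (grafted m n) t := by
  have hi : (j : ℕ) ≤ m + n := by omega
  have hp := triple_point (m := m) (n := n)
  simp only [triple, Prod.mk.injEq] at hp
  have h₂ : value (shortGraftedState m n) (join test t (node point []) j) = none := by
    rw [value_join hi]
    simp [graftedState]
  rw [mem_graftValues_join hi, h₂]
  simp [hp, state]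

theorem zero_mem_test_aux {t : UTree Label} (j : Fin n) :
    0 ∈ graftValues (shortState m n) (grafted m n) (join test t (node aux []) j) ↔
      pureValue (shortState m n) t = some j := by
  have hi : (j : ℕ) ≤ m + n := by omega
  have ha := triple_aux (m := m) (n := n)
  simp only [triple, Prod.mk.injEq] at ha
  have h₂ : value (shortGraftedState m n) (join test t (node aux []) j) = none := by
    rw [value_join hi]
    simp [graftedState]
  rw [mem_graftValues_join hi, h₂]
  simp [ha, state]

theorem zero_mem_aux_point {t : UTree Label} (ht : ∀ b, t ≠ node b []) (j : Fin m) :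
    0 ∈ graftValues (shortState m n) (grafted m n) (join aux t (node point []) j) ↔
      value (shortGraftedState m n) t = some j := by
  have hi : (j : ℕ) ≤ m + n := by omega
  have hp := triple_point (m := m) (n := n)
  simp only [triple, Prod.mk.injEq] at hp
  have hs : ∀ w, state n aux w = none := fun w => by rw [state] <;> simp
  rw [mem_graftValues_join hi, value_join hi, letter_of_ne ht, hp.2.2]
  cases value (shortGraftedState m n) t <;> simp [letter, graftedState, hs, Fin.ext_iff]

theorem value_join_congr {Q : Type} {out : Label → List (Q ⊕ Label) → Option Q} {t t' : UTree Label}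
    (ht : ∀ b, t ≠ node b []) (ht' : ∀ b, t' ≠ node b []) (h : value out t = value out t')
    (a : Label) (y : UTree Label) (j : ℕ) : value out (join a t y j) = value out (join a t' y j) := by
  simp only [join, value.eq_1 _ a, word, letter_of_ne ht, letter_of_ne ht', h]

theorem value_join_none {Q : Type} {out : Label → List (Q ⊕ Label) → Option Q} {t : UTree Label}
    (ht : ∀ b, t ≠ node b []) (h : value out t = none)
    (a : Label) (y : UTree Label) (j : ℕ) : value out (join a t y j) = none := by
  simp [join, value.eq_1 _ a, word, letter_of_ne ht, h]

theorem triple_eq_of_iff {t t' : UTree Label} (ht : ∀ b, t ≠ node b []) (ht' : ∀ b, t' ≠ node b [])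
    (h : ∀ a y j, 0 ∈ graftValues (shortState m n) (grafted m n) (join a t y j) ↔
      0 ∈ graftValues (shortState m n) (grafted m n) (join a t' y j)) :
    triple m n t = triple m n t' := by
  refine Prod.ext (Option.ext fun j => ?_) (Prod.ext (Set.ext fun j => ?_) (Option.ext fun j => ?_))
  · exact (zero_mem_test_aux j).symm.trans ((h _ _ _).trans (zero_mem_test_aux j))
  · exact (zero_mem_test_point j).symm.trans ((h _ _ _).trans (zero_mem_test_point j))
  · exact (zero_mem_aux_point ht j).symm.trans ((h _ _ _).trans (zero_mem_aux_point ht' j))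

theorem triple_eq_none {t : UTree Label} (ht : ∀ b, t ≠ node b [])
    (h : ∀ a y j, 0 ∉ graftValues (shortState m n) (grafted m n) (join a t y j)) :
    triple m n t = (none, ∅, none) := by
  refine Prod.ext (Option.eq_none_iff_forall_ne_some.2 fun j hj => ?_)
    (Prod.ext (Set.eq_empty_of_forall_notMem fun j hj => ?_)
      (Option.eq_none_iff_forall_ne_some.2 fun j hj => ?_))
  · exact h _ _ _ ((zero_mem_test_aux j).2 hj)
  · exact h _ _ _ ((zero_mem_test_point j).2 hj)
  · exact h _ _ _ ((zero_mem_aux_point ht j).2 hj)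

theorem ncard_graftTriples_le {Q : Type} [Fintype Q] (C : SDTA Label Q)
    (hC : ∀ t, t ∈ C.language ↔ 0 ∈ graftValues (shortState m n) (grafted m n) t) :
    (graftTriples (0 : Fin n) (0 : Fin m)).ncard ≤ Fintype.card Q := by
  simp only [SDTA.mem_language] at hC
  choose s hs hx using fun x : graftTriples (0 : Fin n) (0 : Fin m) => exists_triple x.2
  have hsome : ∀ x, ∃ q, value C.outWord (s x) = some q := by
    intro x
    rw [← Option.ne_none_iff_exists']
    intro h
    refine x.2.1 ((hx x).symm.trans (triple_eq_none (hs x) fun a y j hm => ?_))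
    obtain ⟨q, _, hq⟩ := (hC _).2 hm
    rw [value_join_none (hs x) h] at hq
    cases hq
  choose g hg using hsome
  rw [← Nat.card_eq_fintype_card, ← Nat.card_coe_set_eq]
  refine Nat.card_le_card_of_injective g fun x y h => Subtype.ext ?_
  rw [← hx x, ← hx y]
  refine triple_eq_of_iff (hs x) (hs y) fun a z j => ?_
  rw [← hC, ← hC, value_join_congr (hs x) (hs y) (by rw [hg x, hg y, h])]

theorem exists_lower_bound (m n : ℕ) (hm : 1 ≤ m) (hn : 1 ≤ n) :
    ∃ (MA : SDTA Label (Fin m)) (MB : SDTA Label (Fin n)), MB.δ.LeavesCarryStates ∧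
      ∀ (Q : Type) [Fintype Q] (C : SDTA Label Q), C.language = concat MA.language MB.language →
        (n + 1) * ((m + 1) * 2 ^ n - 2 ^ (n - 1)) - 1 ≤ Fintype.card Q := by
  have : NeZero m := ⟨by omega⟩
  have : NeZero n := ⟨by omega⟩
  refine ⟨.ofBounded (bound m n) (graftedState m n) {0},
    .ofBounded (bound m n) (onStates (state n)) {0},
    SDTA.ofBounded_onStates_leavesCarryStates _ _ _, fun Q _ C hC => ?_⟩
  have hA : (SDTA.ofBounded (bound m n) (graftedState m n) {0}).language = grafted m n := by
    ext t
    rw [SDTA.mem_language, SDTA.ofBounded_outWord]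
    exact ⟨fun ⟨q, (h0 : q = 0), hq⟩ => by rw [h0] at hq; exact hq, fun h => ⟨0, rfl, h⟩⟩
  have hlow := ncard_graftTriples_le (m := m) (n := n) C fun t => by
    rw [hC, hA]
    refine ((SDTA.ofBounded_onStates_leavesCarryStates _ _ _).mem_concat_iff
      (f := shortState m n) (fun q a w => ?_)).trans
      ⟨fun ⟨q, (h0 : q = 0), hq⟩ => by rw [h0] at hq; exact hq, fun h => ⟨0, rfl, h⟩⟩
    rw [SDTA.mem_δ, SDTA.ofBounded_outWord, shortState, truncate, truncate, onStates_map_inl,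
      List.length_map]
  rw [ncard_graftTriples, Fintype.card_fin, Fintype.card_fin, mul_comm (2 ^ n)] at hlow
  exact hlow

end Label

theorem theorem4p1 :
    -- upper bound, strongly deterministic automata
    (∀ (α Q₁ Q₂ : Type) [Fintype α] [Fintype Q₁] [Fintype Q₂] [Nonempty Q₁]
        (A₁ : SDTA α Q₁) (A₂ : SDTA α Q₂), A₁.δ.LeavesCarryStates →
      ∃ k : ℕ, k ≤ (Fintype.card Q₁ + 1) *
            (2 ^ Fintype.card Q₁ * (Fintype.card Q₂ + 1) - 2 ^ (Fintype.card Q₁ - 1)) - 1 ∧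
        ∃ B : SDTA α (Fin k), B.language = UTree.concat A₂.language A₁.language) ∧
    -- lower bound, strongly deterministic automata
    (∃ (α : Type) (_ : Fintype α), ∀ m n : ℕ, 1 ≤ m → 1 ≤ n →
      ∃ TA TB : Set (UTree α),
        (∃ MA : SDTA α (Fin m), MA.language = TA) ∧
        (∃ MB : SDTA α (Fin n), MB.δ.LeavesCarryStates ∧ MB.language = TB) ∧
        ∀ (Q : Type) [Fintype Q] (C : SDTA α Q), C.language = UTree.concat TA TB →
          (n + 1) * ((m + 1) * 2 ^ n - 2 ^ (n - 1)) - 1 ≤ Fintype.card Q) ∧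
    -- upper bound, weakly deterministic automata
    (∀ (α Q₁ Q₂ : Type) [Fintype α] [Fintype Q₁] [Fintype Q₂] [Nonempty Q₁]
        (A₁ : WDTA α Q₁) (A₂ : WDTA α Q₂), A₁.δ.LeavesCarryStates →
      ∃ k : ℕ, k ≤ (Fintype.card Q₁ + 1) *
            (2 ^ Fintype.card Q₁ * (Fintype.card Q₂ + 1) - 2 ^ (Fintype.card Q₁ - 1)) - 1 ∧
        ∃ B : WDTA α (Fin k), B.language = UTree.concat A₂.language A₁.language) ∧
    -- lower bound, weakly deterministic automata
    (∃ (α : Type) (_ : Fintype α), ∀ m n : ℕ, 1 ≤ m → 1 ≤ n →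
      ∃ TA TB : Set (UTree α),
        (∃ MA : WDTA α (Fin m), MA.language = TA) ∧
        (∃ MB : WDTA α (Fin n), MB.δ.LeavesCarryStates ∧ MB.language = TB) ∧
        ∀ (Q : Type) [Fintype Q] (C : WDTA α Q), C.language = UTree.concat TA TB →
          (n + 1) * ((m + 1) * 2 ^ n - 2 ^ (n - 1)) - 1 ≤ Fintype.card Q) := by

  refine ⟨fun α Q₁ Q₂ _ _ _ _ A₁ A₂ h => SDTA.exists_concatenation A₁ A₂ h,
    ⟨Label, inferInstance, fun m n hm hn => ?_⟩, fun α Q₁ Q₂ _ _ _ _ A₁ A₂ h => ?_,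
    ⟨Label, inferInstance, fun m n hm hn => ?_⟩⟩
  · obtain ⟨MA, MB, hB, h⟩ := Label.exists_lower_bound m n hm hn
    exact ⟨_, _, ⟨MA, rfl⟩, ⟨MB, hB, rfl⟩, h⟩
  · obtain ⟨B₁, hδ, h₁⟩ := A₁.exists_sdta
    obtain ⟨B₂, _, h₂⟩ := A₂.exists_sdta
    obtain ⟨k, hk, B, hB⟩ := SDTA.exists_concatenation B₁ B₂ (hδ ▸ h)
    exact ⟨k, hk, B.toWDTA, by rw [← h₁, ← h₂, ← hB]; rfl⟩
  · obtain ⟨MA, MB, hB, h⟩ := Label.exists_lower_bound m n hm hn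
    refine ⟨_, _, ⟨MA.toWDTA, rfl⟩, ⟨MB.toWDTA, hB, rfl⟩, fun Q _ C hC => ?_⟩
    obtain ⟨D, _, hD⟩ := C.exists_sdta
    exact h Q D (hD.trans hC)
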